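/- Let $A$ be a finite set of $N$ options, let $\Pi=\{xy\in A\times A: x\ne y\}$, and let $$\Omega=\{v\in[0,1]^{\Pi}: v_{xy}+v_{yx}\le 1 \text{ for all } xy\in\Pi\}$$ be the set of Llull matrices. For $v\in\Omega$ consider the following procedure. 1. The turnouts are $t_{xy}=v_{xy}+v_{yx}$. The indirect scores $v^*_{xy}$ ($x\ne y$) are the maxima of $\min_{0\le i<n}v_{x_ix_{i+1}}$ over all paths $x=x_0,x_1,\dots,x_n=y$ ($n\ge1$, $x_i\neq x_{i+1}$), and the indirect margins are $m^*_{xy}=v^*_{xy}-v^*_{yx}$. 2. An admissible order for $v$ is a (strict) total order $\xi$ on $A$ with $x\mathrel{\xi}y$ whenever $m^*_{xy}>0$. Fix one; write $\xi_=$ for its reflexive closure and $x'$ for the immediate successor of $x$ in $\xi$. 3. For $x\mathrel{\xi}y$ put $m^\sigma_{xy}=\min\{m^*_{pq}: p\mathrel{\xi_=}x,\ y\mathrel{\xi_=}q\}$. 4. Let $(t^\sigma_{xy})$ be the minimizer of $\sum_{x}\sum_{y\ne x}(\tau_{xy}-t_{xy})^2$ over the real matrices $(\tau_{xy})_{xy\in\Pi}$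 such that $\tau_{xy}=\tau_{yx}$, $m^\sigma_{xx'}\le\tau_{xx'}\le1$, and $0\le\tau_{xz}-\tau_{x'z}\le m^\sigma_{xx'}$ for $z\notin\{x,x'\}$. 5. Let $\gamma_{xx'}=[(t^\sigma_{xx'}-m^\sigma_{xx'})/2,\ (t^\sigma_{xx'}+m^\sigma_{xx'})/2]$ and, for $x\mathrel{\xi}y$, let $\gamma_{xy}=\bigcup\{\gamma_{pp'}: x\mathrel{\xi_=}p\mathrel{\xi}y\}$. The projected scores are $v^\pi_{xy}=\max\gamma_{xy}$ and $v^\pi_{yx}=\min\gamma_{xy}$ for $x\mathrel{\xi}y$. 6. The rank-like rates are $R_x=N-\sum_{y\ne x}v^\pi_{xy}$. Then the following holds. (i) The projected scores are well defined: every $v\in\Omega$ has an admissible order, and for every admissible order the procedure yields exactly one matrix $(v^\pi_{xy})$, which does not depend on that order. (ii) The projected scores $v^\pi_{xy}$ ($xy\in\Pi$) and the rank-like rates $R_x$ ($x\in A$) are continuous functions of $v\in\Omega$. (iii) The rank-like rates depend continuously on the relative frequencies of the possible individual votes: for every set $K$ of possible votes (finite or not), with vote $k$ given by a matrix $v^k\in\Omega$,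 the rates $R_x$ of the collective Llull matrix $v_{xy}=\sum_{k}\alpha_k v^k_{xy}$ are continuous functions of $\alpha=(\alpha_k)_{k\in K}$ on $\{\alpha\in\mathbb R^K:\alpha_k\ge0,\ \sum_k\alpha_k=1\}$ with the topology of coordinatewise convergence. -/

import Mathlib

open Set
open scoped BigOperators

namespace CLC

/-- The ordered pairs `xy` of distinct options. -/
abbrev Pair (A : Type*) : Type _ := {p : A × A // p.1 ≠ p.2}

/-- The pair `yx` associated with the pair `xy`. -/
def Pair.rev {A : Type*} (p : Pair A) : Pair A := ⟨(p.1.2, p.1.1), p.2.symm⟩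

/-- The set `Ω` of Llull matrices: `v_xy ∈ [0,1]` and `v_xy + v_yx ≤ 1`. -/
def Omega (A : Type*) : Set (Pair A → ℝ) :=
  {v | ∀ p : Pair A, v p ∈ Icc (0 : ℝ) 1 ∧ v p + v p.rev ≤ 1}

open Classical in
/-- The entry `v_xy` of a matrix indexed by the pairs of distinct options. The value `0` on the
diagonal is a mere convention; no quantity below depends on it. -/
noncomputable def entry {A : Type*} (v : Pair A → ℝ) (x y : A) : ℝ :=
  if h : x ≠ y then v ⟨(x, y), h⟩ else 0

/-- The turnouts `t_xy = v_xy + v_yx`. -/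
def turnout {A : Type*} (v : Pair A → ℝ) : Pair A → ℝ := fun p => v p + v p.rev

/-- `c 0, c 1, …, c n` is a path from `x` to `y`. -/
def IsPath {A : Type*} (n : ℕ) (c : ℕ → A) (x y : A) : Prop :=
  0 < n ∧ c 0 = x ∧ c n = y ∧ ∀ i < n, c i ≠ c (i + 1)

/-- The score of the path `c 0, …, c n`: the least score of its links. -/
noncomputable def pathScore {A : Type*} (v : Pair A → ℝ) (n : ℕ) (c : ℕ → A) : ℝ :=
  ⨅ i : Fin n, entry v (c i) (c (i + 1))

/-- The indirect score of `xy`: the largest score of a path from `x` to `y`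
(the path scores take finitely many values, so that the supremum is a maximum). -/
noncomputable def indirectScore {A : Type*} (v : Pair A → ℝ) (x y : A) : ℝ :=
  sSup {r | ∃ (n : ℕ) (c : ℕ → A), IsPath n c x y ∧ r = pathScore v n c}

/-- The indirect margins. -/
noncomputable def indirectMargin {A : Type*} (v : Pair A → ℝ) (x y : A) : ℝ :=
  indirectScore v x y - indirectScore v y x

/-- `ξ` is an admissible order for `v`: a (strict) total order on the options that contains the
indirect comparison relation. -/
def IsAdmissible {A : Type*} (v : Pair A → ℝ) (ξ : A → A → Prop) : Prop :=
  IsStrictTotalOrder A ξ ∧ ∀ x y : A, 0 < indirectMargin v x y → ξ x y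

/-- The reflexive version of the order `ξ`. -/
def Weak {A : Type*} (ξ : A → A → Prop) (x y : A) : Prop := x = y ∨ ξ x y

/-- `x'` is the immediate successor of `x` in `ξ`. -/
def IsNext {A : Type*} (ξ : A → A → Prop) (x x' : A) : Prop :=
  ξ x x' ∧ ∀ z : A, ¬ (ξ x z ∧ ξ z x')

/-- The intermediate projected margin of `xy` (for `x` before `y` in `ξ`): the least indirect
margin of `pq`, where `p` is `x` or precedes it, and `q` is `y` or follows it. -/
noncomputable def interMargin {A : Type*} (v : Pair A → ℝ) (ξ : A → A → Prop) (x y : A) : ℝ :=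
  sInf {r | ∃ p q : A, Weak ξ p x ∧ Weak ξ y q ∧ r = indirectMargin v p q}

/-- The restrictions on the intermediate projected turnouts. -/
def turnoutSet {A : Type*} (v : Pair A → ℝ) (ξ : A → A → Prop) : Set (Pair A → ℝ) :=
  {τ | (∀ x y : A, x ≠ y → entry τ x y = entry τ y x) ∧
    (∀ x x' : A, IsNext ξ x x' → interMargin v ξ x x' ≤ entry τ x x' ∧ entry τ x x' ≤ 1) ∧
    (∀ x x' z : A, IsNext ξ x x' → z ≠ x → z ≠ x' →
      0 ≤ entry τ x z - entry τ x' z ∧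
        entry τ x z - entry τ x' z ≤ interMargin v ξ x x')}

open Classical in
/-- The quadratic deviation `Φ` between two matrices of turnouts. -/
noncomputable def deviation {A : Type*} [Fintype A] (t τ : Pair A → ℝ) : ℝ :=
  ∑ x : A, ∑ y ∈ Finset.univ.erase x, (entry τ x y - entry t x y) ^ 2

/-- `τ` is a matrix of intermediate projected turnouts of `v` with respect to `ξ`. -/
def IsInterTurnout {A : Type*} [Fintype A] (v : Pair A → ℝ) (ξ : A → A → Prop)
    (τ : Pair A → ℝ) : Prop :=
  τ ∈ turnoutSet v ξ ∧ ∀ σ ∈ turnoutSet v ξ, deviation (turnout v) τ ≤ deviation (turnout v) σ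

/-- The set `γ_xy` (for `x` before `y` in `ξ`): the union of the elementary intervals
`[(τ_pp' - m_pp') / 2, (τ_pp' + m_pp') / 2]`, where `p` is `x` or follows it, `p` precedes `y`,
and `p'` is the immediate successor of `p`. -/
def gammaSet {A : Type*} (v : Pair A → ℝ) (ξ : A → A → Prop) (τ : Pair A → ℝ) (x y : A) : Set ℝ :=
  {r | ∃ p p' : A, Weak ξ x p ∧ ξ p y ∧ IsNext ξ p p' ∧
    r ∈ Icc ((entry τ p p' - interMargin v ξ p p') / 2)
      ((entry τ p p' + interMargin v ξ p p') / 2)}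

/-- `s` is a matrix of projected scores of `v` computed by means of the order `ξ`:
`s_xy = max γ_xy` and `s_yx = min γ_xy` whenever `x` precedes `y` in `ξ`. -/
def IsProjection {A : Type*} [Fintype A] (v : Pair A → ℝ) (ξ : A → A → Prop)
    (s : Pair A → ℝ) : Prop :=
  ∃ τ : Pair A → ℝ, IsInterTurnout v ξ τ ∧
    ∀ x y : A, ξ x y →
      IsGreatest (gammaSet v ξ τ x y) (entry s x y) ∧
      IsLeast (gammaSet v ξ τ x y) (entry s y x)

/-- The matrix of projected scores of `v`, computed by means of some admissible order. -/
noncomputable def projectedScores {A : Type*} [Fintype A] (v : Pair A → ℝ) : Pair A → ℝ :=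
  Classical.epsilon fun s => ∃ ξ : A → A → Prop, IsAdmissible v ξ ∧ IsProjection v ξ s

open Classical in
/-- The rank-like rate of the option `x`. -/
noncomputable def rankLikeRate {A : Type*} [Fintype A] (v : Pair A → ℝ) (x : A) : ℝ :=
  (Fintype.card A : ℝ) - ∑ y ∈ Finset.univ.erase x, entry (projectedScores v) x y

/-- The systems of relative frequencies `α_k` of the possible individual votes `k ∈ K`
(for a finite set `K`, this is the standard simplex). -/
def Frequencies (K : Type*) : Set (K → ℝ) :=
  {α | (∀ k : K, 0 ≤ α k) ∧ HasSum α 1}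

/-- The collective Llull matrix, i.e. the centre of gravity of the individual votes `w k`
with weights `α k`. -/
noncomputable def collective {A K : Type*} (w : K → Pair A → ℝ) (α : K → ℝ) : Pair A → ℝ :=
  fun p => ∑' k : K, α k * w k p

end CLC

/-! Indirect scores satisfy a max-min transitivity, so positive indirect margins form a strict
partial order, which extends to a total order: admissible orders exist. For a fixed admissible
order, the constraints on the turnouts define a closed convex set containing the constant matrix 1.
Compactness of a large box gives a minimizer, and strict convexity of the deviation makes it unique.
The projected scores are then maxima and minima of finitely many interval endpoints.

Independence of the order reduces to transposing consecutive options `a`, `b`, because two total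
orders are joined by such transpositions, each removing an inversion. If both orders are admissible,
an inverted pair has indirect margin zero. The link `ab` then has intermediate margin zero, feasible
turnouts do not distinguish `a` from `b`, and the transposition preserves the feasible set and the
scores (`IsProjection.swapRel`, `IsProjection.of_isAdmissible`).

For continuity, the sets of matrices admitting a given order are finitely many closed sets covering
`Omega A`, so continuity on each suffices. There the margins are continuous, and the minimizer is
handled by compactness: any cluster point is feasible, and is optimal because every feasible
competitor, moved slightly towards 1, stays feasible nearby
(`eventually_combination_mem_turnoutSet`). Uniqueness of the minimizer identifies the cluster point.
Part (iii) composes this with continuity of the collective matrix in the weights, where total mass 1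
prevents loss of mass in the limit. -/

namespace CLC

/-! ### Indirect scores and existence of admissible orders -/

section Scores

variable {A : Type*}

lemma entry_of_ne (v : Pair A → ℝ) {x y : A} (h : x ≠ y) : entry v x y = v ⟨(x, y), h⟩ := by
  simp [entry, h]

lemma entry_pair (v : Pair A → ℝ) (p : Pair A) : entry v p.1.1 p.1.2 = v p :=
  entry_of_ne v p.2

lemma entry_mem {v : Pair A → ℝ} (hv : v ∈ Omega A) (x y : A) : entry v x y ∈ Icc (0 : ℝ) 1 := by
  unfold entry
  split_ifs
  · exact (hv _).1
  · simp

lemma entry_le_add {v w : Pair A → ℝ} {ε : ℝ} (hε : 0 ≤ ε) (h : ∀ p, v p ≤ w p + ε) (x y : A) :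
    entry v x y ≤ entry w x y + ε := by
  unfold entry
  split_ifs
  · exact h _
  · simpa using hε

lemma entry_combination (a b : ℝ) (v w : Pair A → ℝ) (x y : A) :
    entry (fun p => a * v p + b * w p) x y = a * entry v x y + b * entry w x y := by
  unfold entry
  split_ifs <;> simp

lemma continuous_entry (x y : A) : Continuous fun v : Pair A → ℝ => entry v x y := by
  unfold entry
  split_ifs
  · exact continuous_apply _
  · exact continuous_const

lemma pathScore_le (v : Pair A → ℝ) {n : ℕ} (c : ℕ → A) {i : ℕ} (hi : i < n) :
    pathScore v n c ≤ entry v (c i) (c (i + 1)) :=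
  ciInf_le (f := fun i : Fin n => entry v (c i) (c (i + 1))) (finite_range _).bddBelow ⟨i, hi⟩

lemma le_pathScore {v : Pair A → ℝ} {n : ℕ} {c : ℕ → A} {r : ℝ} (hn : 0 < n)
    (h : ∀ i < n, r ≤ entry v (c i) (c (i + 1))) : r ≤ pathScore v n c := by
  have : Nonempty (Fin n) := ⟨⟨0, hn⟩⟩
  exact le_ciInf fun i => h i i.2

lemma pathScore_mem {v : Pair A → ℝ} (hv : v ∈ Omega A) {n : ℕ} (hn : 0 < n) (c : ℕ → A) :
    pathScore v n c ∈ Icc (0 : ℝ) 1 :=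
  ⟨le_pathScore hn fun _ _ => (entry_mem hv _ _).1,
    (pathScore_le v c hn).trans (entry_mem hv _ _).2⟩

lemma pathScore_le_indirectScore {v : Pair A → ℝ} (hv : v ∈ Omega A) {n : ℕ} {c : ℕ → A} {x y : A}
    (h : IsPath n c x y) : pathScore v n c ≤ indirectScore v x y := by
  refine le_csSup ⟨1, ?_⟩ ⟨n, c, h, rfl⟩
  rintro r ⟨m, d, hd, rfl⟩
  exact (pathScore_mem hv hd.1 d).2

lemma isPath_of_ne {x y : A} (h : x ≠ y) : IsPath 1 (fun i => if i = 0 then x else y) x y := by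
  refine ⟨one_pos, by simp, by simp, ?_⟩
  intro i hi
  obtain rfl : i = 0 := by omega
  simpa using h

lemma indirectScore_le {v : Pair A → ℝ} {x y : A} {r : ℝ} (hxy : x ≠ y)
    (h : ∀ n c, IsPath n c x y → pathScore v n c ≤ r) : indirectScore v x y ≤ r := by
  refine csSup_le ⟨_, 1, _, isPath_of_ne hxy, rfl⟩ ?_
  rintro _ ⟨n, c, hc, rfl⟩
  exact h n c hc

lemma indirectScore_mem {v : Pair A → ℝ} (hv : v ∈ Omega A) {x y : A} (hxy : x ≠ y) :
    indirectScore v x y ∈ Icc (0 : ℝ) 1 :=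
  ⟨(pathScore_mem hv one_pos _).1.trans (pathScore_le_indirectScore hv (isPath_of_ne hxy)),
    indirectScore_le hxy fun _ _ hc => (pathScore_mem hv hc.1 _).2⟩

/-- The same path serves for both matrices, and its weakest link moves by at most `ε`. This makes
indirect scores 1-Lipschitz for the sup norm. -/
lemma indirectScore_le_add {v w : Pair A → ℝ} (hw : w ∈ Omega A) {ε : ℝ}
    (hε : 0 ≤ ε) (h : ∀ p, v p ≤ w p + ε) {x y : A} (hxy : x ≠ y) :
    indirectScore v x y ≤ indirectScore w x y + ε := by
  refine indirectScore_le hxy fun n c hc => ?_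
  have h1 : pathScore v n c - ε ≤ pathScore w n c := by
    refine le_pathScore hc.1 fun i hi => ?_
    linarith [pathScore_le v c hi, entry_le_add hε h (c i) (c (i + 1))]
  linarith [pathScore_le_indirectScore hw hc]

/-- Concatenation of paths. -/
lemma IsPath.append {x y z : A} {n m : ℕ} {c d : ℕ → A} (hc : IsPath n c x y)
    (hd : IsPath m d y z) :
    ∃ e : ℕ → A, IsPath (n + m) e x z ∧ ∀ i < n + m,
      (∃ j < n, e i = c j ∧ e (i + 1) = c (j + 1)) ∨
      (∃ j < m, e i = d j ∧ e (i + 1) = d (j + 1)) := by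
  obtain ⟨hn, hc0, hcn, hcs⟩ := hc
  obtain ⟨hm, hd0, hdm, hds⟩ := hd
  set e : ℕ → A := fun i => if i ≤ n then c i else d (i - n) with he
  have he1 : ∀ i ≤ n, e i = c i := fun i hi => by simp [he, hi]
  have he2 : ∀ j, e (n + j) = d j := by
    intro j
    rcases Nat.eq_zero_or_pos j with rfl | hj
    · simp [he, hcn, hd0]
    · have : ¬ n + j ≤ n := by omega
      simp [he, this]
  have key : ∀ i < n + m, (∃ j < n, e i = c j ∧ e (i + 1) = c (j + 1)) ∨
      (∃ j < m, e i = d j ∧ e (i + 1) = d (j + 1)) := by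
    intro i hi
    by_cases h : i < n
    · exact Or.inl ⟨i, h, he1 i h.le, he1 _ h⟩
    · obtain ⟨j, rfl⟩ := Nat.exists_eq_add_of_le (not_lt.1 h)
      exact Or.inr ⟨j, by omega, he2 j, he2 (j + 1)⟩
  refine ⟨e, ⟨by omega, ?_, ?_, ?_⟩, key⟩
  · rw [he1 0 (Nat.zero_le _), hc0]
  · rw [he2, hdm]
  · intro i hi
    rcases key i hi with ⟨j, hj, h1, h2⟩ | ⟨j, hj, h1, h2⟩
    · rw [h1, h2]; exact hcs j hj
    · rw [h1, h2]; exact hds j hj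

lemma min_le_indirectScore {v : Pair A → ℝ} (hv : v ∈ Omega A) {x y : A} (hxy : x ≠ y) {z : A}
    (hyz : y ≠ z) :
    min (indirectScore v x y) (indirectScore v y z) ≤ indirectScore v x z := by
  refine le_of_forall_lt fun r hr => ?_
  obtain ⟨h1, h2⟩ := lt_min_iff.1 hr
  obtain ⟨_, ⟨n, c, hc, rfl⟩, hrc⟩ :=
    exists_lt_of_lt_csSup (s := {r | ∃ (n : ℕ) (c : ℕ → A), IsPath n c x y ∧ r = pathScore v n c})
      ⟨_, 1, _, isPath_of_ne hxy, rfl⟩ h1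
  obtain ⟨_, ⟨m, d, hd, rfl⟩, hrd⟩ :=
    exists_lt_of_lt_csSup (s := {r | ∃ (n : ℕ) (c : ℕ → A), IsPath n c y z ∧ r = pathScore v n c})
      ⟨_, 1, _, isPath_of_ne hyz, rfl⟩ h2
  obtain ⟨e, he, hed⟩ := hc.append hd
  have h3 : min (pathScore v n c) (pathScore v m d) ≤ pathScore v (n + m) e := by
    refine le_pathScore he.1 fun i hi => ?_
    rcases hed i hi with ⟨j, hj, h1, h2⟩ | ⟨j, hj, h1, h2⟩
    · rw [h1, h2]; exact (min_le_left _ _).trans (pathScore_le v c hj)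
    · rw [h1, h2]; exact (min_le_right _ _).trans (pathScore_le v d hj)
  exact (lt_min hrc hrd).trans_le (h3.trans (pathScore_le_indirectScore hv he))

lemma indirectMargin_self (v : Pair A → ℝ) (x : A) : indirectMargin v x x = 0 := sub_self _

lemma indirectMargin_neg (v : Pair A → ℝ) (x y : A) :
    indirectMargin v y x = - indirectMargin v x y := by
  simp [indirectMargin]

lemma indirectMargin_le_one {v : Pair A → ℝ} (hv : v ∈ Omega A) (x y : A) :
    indirectMargin v x y ≤ 1 := by
  by_cases h : x = y
  · subst h; rw [indirectMargin_self]; exact zero_le_one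
  · have h1 := indirectScore_mem hv h
    have h2 := indirectScore_mem hv (Ne.symm h)
    unfold indirectMargin
    linarith [h1.2, h2.1]

/-- If the conclusion failed, the smaller of the scores of `xy` and `yz` would bound from below the
scores of `xz` and hence of `zx`. Going on around the cycle, it would be at most its own reverse
score, against the positivity of its margin. -/
lemma indirectMargin_pos_trans {v : Pair A → ℝ} (hv : v ∈ Omega A) {x y z : A}
    (hxy : 0 < indirectMargin v x y) (hyz : 0 < indirectMargin v y z) :
    0 < indirectMargin v x z := by
  have nxy : x ≠ y := by rintro rfl; simp [indirectMargin_self] at hxy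
  have nyz : y ≠ z := by rintro rfl; simp [indirectMargin_self] at hyz
  have nxz : x ≠ z := by
    rintro rfl
    rw [indirectMargin_neg] at hyz
    linarith
  unfold indirectMargin at *
  by_contra hcon
  have a1 := min_le_indirectScore hv nxy nyz
  have a2 := min_le_indirectScore hv nyz nxz.symm
  have a3 := min_le_indirectScore hv nxz.symm nxy
  rcases le_total (indirectScore v x y) (indirectScore v y z) with h | h
  · rw [min_eq_left h] at a1
    have : indirectScore v x y ≤ indirectScore v y x :=
      (le_min h (by linarith)).trans a2
    linarith
  · rw [min_eq_right h] at a1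
    have : indirectScore v y z ≤ indirectScore v z y :=
      (le_min (by linarith) h).trans a3
    linarith

lemma continuousOn_indirectMargin [Finite A] (x y : A) :
    ContinuousOn (fun v : Pair A → ℝ => indirectMargin v x y) (Omega A) := by
  classical
  have := Fintype.ofFinite A
  by_cases hxy : x = y
  · subst hxy
    simpa only [indirectMargin_self] using continuousOn_const
  have key : ∀ x y : A, x ≠ y →
      ContinuousOn (fun v : Pair A → ℝ => indirectScore v x y) (Omega A) := by
    intro x y h
    refine (LipschitzOnWith.of_dist_le_mul (K := 1) fun v hv w hw => ?_).continuousOn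
    have h1 : ∀ v w : Pair A → ℝ, ∀ p, v p ≤ w p + dist v w := fun v w p => by
      have := (abs_le.1 ((Real.dist_eq _ _).symm.le.trans (dist_le_pi_dist v w p))).2
      linarith
    have h2 := indirectScore_le_add hw dist_nonneg (h1 v w) h
    have h3 := indirectScore_le_add hv dist_nonneg (h1 w v) h
    rw [dist_comm w v] at h3
    rw [Real.dist_eq, NNReal.coe_one, one_mul, abs_le]
    constructor <;> linarith
  exact (key x y hxy).sub (key y x (Ne.symm hxy))

lemma isClosed_omega : IsClosed (Omega A) := by
  simp only [Omega, mem_Icc, ofPred_forall]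
  refine isClosed_iInter fun p => ?_
  exact ((isClosed_le continuous_const (continuous_apply p)).inter
    (isClosed_le (continuous_apply p) continuous_const)).inter
    (isClosed_le ((continuous_apply p).add (continuous_apply p.rev)) continuous_const)

lemma isStrictTotalOrder_of {ξ : A → A → Prop} (irr : ∀ x, ¬ ξ x x)
    (tr : ∀ x y z, ξ x y → ξ y z → ξ x z) (tri : ∀ x y, x ≠ y → ξ x y ∨ ξ y x) :
    IsStrictTotalOrder A ξ :=
  { trichotomous := fun x y h1 h2 => by
      by_contra h
      exact (tri x y h).elim h1 h2
    irrefl := irr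
    trans := tr }

/-- Szpilrajn extension of the partial order generated by the positive indirect margins. -/
lemma exists_isAdmissible {v : Pair A → ℝ} (hv : v ∈ Omega A) :
    ∃ ξ : A → A → Prop, IsAdmissible v ξ := by
  set r : A → A → Prop := fun x y => x = y ∨ 0 < indirectMargin v x y with hr
  have : IsPartialOrder A r :=
    { refl := fun x => Or.inl rfl
      trans := by
        rintro x y z (rfl | h1) (rfl | h2)
        · exact Or.inl rfl
        · exact Or.inr h2
        · exact Or.inr h1
        · exact Or.inr (indirectMargin_pos_trans hv h1 h2)
      antisymm := by
        rintro x y (rfl | h1) (h | h2)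
        · rfl
        · rfl
        · exact h.symm
        · rw [indirectMargin_neg] at h2
          linarith }
  obtain ⟨s, hs, hrs⟩ := extend_partialOrder r
  refine ⟨fun x y => s x y ∧ x ≠ y, isStrictTotalOrder_of (fun x h => h.2 rfl) ?_ ?_, ?_⟩
  · rintro x y z ⟨h1, h2⟩ ⟨h3, h4⟩
    refine ⟨_root_.trans h1 h3, ?_⟩
    rintro rfl
    exact h2 (antisymm h1 h3)
  · intro x y h
    rcases total_of s x y with h1 | h1
    · exact Or.inl ⟨h1, h⟩
    · exact Or.inr ⟨h1, h.symm⟩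
  · intro x y h
    refine ⟨hrs x y (Or.inr h), ?_⟩
    rintro rfl
    simp [indirectMargin_self] at h

end Scores

/-! ### Consecutive options and intermediate margins -/

section Orders

variable {A : Type*} {ξ : A → A → Prop}

lemma Weak.trans_rel [IsStrictTotalOrder A ξ] {x y z : A} (h : Weak ξ x y) (h' : ξ y z) :
    ξ x z := by
  rcases h with rfl | h
  · exact h'
  · exact _root_.trans h h'

lemma Weak.rel_trans [IsStrictTotalOrder A ξ] {x y z : A} (h : ξ x y) (h' : Weak ξ y z) :
    ξ x z := by
  rcases h' with rfl | h'
  · exact h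
  · exact _root_.trans h h'

lemma weak_of_not [IsStrictTotalOrder A ξ] {x y : A} (h : ¬ ξ y x) : Weak ξ x y := by
  rcases trichotomous_of ξ x y with h1 | h1 | h1
  · exact Or.inr h1
  · exact Or.inl h1
  · exact absurd h1 h

lemma ne_of_rel [IsStrictTotalOrder A ξ] {x y : A} (h : ξ x y) : x ≠ y := by
  rintro rfl
  exact irrefl_of ξ x h

lemma not_rel_of_rel [IsStrictTotalOrder A ξ] {x y : A} (h : ξ x y) : ¬ ξ y x :=
  fun h' => irrefl_of ξ x (_root_.trans h h')

lemma IsNext.weak_of_rel [IsStrictTotalOrder A ξ] {x x' y : A} (h : IsNext ξ x x') (hy : ξ x y) :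
    Weak ξ x' y :=
  weak_of_not fun h' => h.2 y ⟨hy, h'⟩

lemma IsNext.weak_of_rel' [IsStrictTotalOrder A ξ] {x x' y : A} (h : IsNext ξ x x')
    (hy : ξ y x') : Weak ξ y x :=
  weak_of_not fun h' => h.2 y ⟨h', hy⟩

lemma exists_isNext [Finite A] [IsStrictTotalOrder A ξ] {x y : A} (h : ξ x y) :
    ∃ x', IsNext ξ x x' := by
  obtain ⟨m, hm, hmin⟩ := (Finite.wellFounded_of_trans_of_irrefl ξ).has_min {z | ξ x z} ⟨y, h⟩
  exact ⟨m, hm, fun z hz => hmin z hz.1 hz.2⟩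

lemma exists_isNext' [Finite A] [IsStrictTotalOrder A ξ] {x y : A} (h : ξ x y) :
    ∃ y', IsNext ξ y' y := by
  obtain ⟨m, hm, hmin⟩ :=
    (Finite.wellFounded_of_trans_of_irrefl (Function.swap ξ)).has_min {z | ξ z y} ⟨x, h⟩
  exact ⟨m, hm, fun z hz => hmin z hz.2 hz.1⟩

lemma IsAdmissible.indirectMargin_nonneg {v : Pair A → ℝ} (hξ : IsAdmissible v ξ) {x y : A}
    (h : ξ x y) : 0 ≤ indirectMargin v x y := by
  have := hξ.1
  by_contra hcon
  refine not_rel_of_rel h (hξ.2 y x ?_)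
  rw [indirectMargin_neg]
  linarith

/-- By totality, admissibility becomes a family of weak inequalities, hence a closed condition on
`v`. -/
lemma isAdmissible_iff [hξ : IsStrictTotalOrder A ξ] {v : Pair A → ℝ} :
    IsAdmissible v ξ ↔ ∀ x y, ξ x y → 0 ≤ indirectMargin v x y := by
  refine ⟨fun h x y hxy => h.indirectMargin_nonneg hxy, fun h => ⟨hξ, fun x y hxy => ?_⟩⟩
  have hne : x ≠ y := by rintro rfl; simp [indirectMargin_self] at hxy
  rcases trichotomous_of ξ x y with h1 | h1 | h1
  · exact h1
  · exact absurd h1 hne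
  · have := h y x h1
    rw [indirectMargin_neg] at this
    linarith

lemma interMargin_le {v : Pair A → ℝ} [Finite A] {x y p q : A} (hp : Weak ξ p x)
    (hq : Weak ξ y q) : interMargin v ξ x y ≤ indirectMargin v p q := by
  refine csInf_le (Set.Finite.bddBelow ?_) ⟨p, q, hp, hq, rfl⟩
  refine (Set.finite_range fun r : A × A => indirectMargin v r.1 r.2).subset ?_
  rintro _ ⟨p, q, -, -, rfl⟩
  exact ⟨(p, q), rfl⟩

lemma IsAdmissible.interMargin_nonneg {v : Pair A → ℝ} (hξ : IsAdmissible v ξ) {x y : A}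
    (h : ξ x y) : 0 ≤ interMargin v ξ x y := by
  have := hξ.1
  refine Real.sInf_nonneg ?_
  rintro _ ⟨p, q, hp, hq, rfl⟩
  exact hξ.indirectMargin_nonneg (hp.trans_rel (Weak.rel_trans h hq))

lemma interMargin_le_one [Finite A] {v : Pair A → ℝ} (hv : v ∈ Omega A) (x y : A) :
    interMargin v ξ x y ≤ 1 :=
  (interMargin_le (Or.inl rfl) (Or.inl rfl)).trans (indirectMargin_le_one hv x y)

lemma IsAdmissible.interMargin_eq_zero [Finite A] {v : Pair A → ℝ} (hξ : IsAdmissible v ξ)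
    {x y : A} (h : ξ x y) (h0 : indirectMargin v x y = 0) : interMargin v ξ x y = 0 :=
  le_antisymm ((interMargin_le (Or.inl rfl) (Or.inl rfl)).trans h0.le) (hξ.interMargin_nonneg h)

lemma continuousOn_interMargin [Finite A] (ξ : A → A → Prop) (x y : A) :
    ContinuousOn (fun v : Pair A → ℝ => interMargin v ξ x y) (Omega A) := by
  classical
  have := Fintype.ofFinite A
  set S : Finset (A × A) := Finset.univ.filter fun r => Weak ξ r.1 x ∧ Weak ξ y r.2 with hS
  have hne : S.Nonempty := ⟨(x, y), Finset.mem_filter.2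
    ⟨Finset.mem_univ _, Or.inl rfl, Or.inl rfl⟩⟩
  have heq : (fun v : Pair A → ℝ => interMargin v ξ x y) =
      fun v => S.inf' hne fun r => indirectMargin v r.1 r.2 := by
    funext v
    rw [Finset.inf'_eq_csInf_image, interMargin]
    congr 1
    ext r
    constructor
    · rintro ⟨p, q, hp, hq, rfl⟩
      exact ⟨(p, q), by simp [hS, hp, hq], rfl⟩
    · rintro ⟨⟨p, q⟩, h, rfl⟩
      simp only [hS, Finset.coe_filter, Finset.mem_univ, true_and, mem_ofPred_eq] at h
      exact ⟨p, q, h.1, h.2, rfl⟩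
  rw [heq]
  exact ContinuousOn.finset_inf'_apply hne fun r _ => continuousOn_indirectMargin r.1 r.2

end Orders

/-! ### Existence and uniqueness of the intermediate turnouts -/

section Turnouts

variable {A : Type*} {ξ : A → A → Prop} {v : Pair A → ℝ}

lemma entry_one {x y : A} (h : x ≠ y) : entry (fun _ => (1 : ℝ)) x y = 1 := entry_of_ne _ h

lemma one_mem_turnoutSet [Finite A] (hv : v ∈ Omega A) (hξ : IsAdmissible v ξ) :
    (fun _ => (1 : ℝ)) ∈ turnoutSet v ξ := by
  have := hξ.1
  refine ⟨fun x y h => ?_, fun x x' h => ?_, fun x x' z h h1 h2 => ?_⟩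
  · rw [entry_one h, entry_one h.symm]
  · rw [entry_one (ne_of_rel h.1)]
    exact ⟨interMargin_le_one hv _ _, le_rfl⟩
  · rw [entry_one h1.symm, entry_one h2.symm, sub_self]
    exact ⟨le_rfl, hξ.interMargin_nonneg h.1⟩

lemma isClosed_turnoutSet : IsClosed (turnoutSet v ξ) := by
  have ce := continuous_entry (A := A)
  simp only [turnoutSet, ofPred_and, ofPred_forall]
  refine (isClosed_iInter fun x => isClosed_iInter fun y => isClosed_iInter fun _ =>
    isClosed_eq (ce x y) (ce y x)).inter (.inter ?_ ?_)
  · exact isClosed_iInter fun x => isClosed_iInter fun y => isClosed_iInter fun _ =>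
      (isClosed_le continuous_const (ce x y)).inter (isClosed_le (ce x y) continuous_const)
  · exact isClosed_iInter fun x => isClosed_iInter fun y => isClosed_iInter fun z =>
      isClosed_iInter fun _ => isClosed_iInter fun _ => isClosed_iInter fun _ =>
      (isClosed_le continuous_const ((ce x z).sub (ce y z))).inter
        (isClosed_le ((ce x z).sub (ce y z)) continuous_const)

lemma midpoint_mem_turnoutSet {σ τ : Pair A → ℝ} (hσ : σ ∈ turnoutSet v ξ)
    (hτ : τ ∈ turnoutSet v ξ) :
    (fun p => (1 / 2 : ℝ) * σ p + (1 / 2 : ℝ) * τ p) ∈ turnoutSet v ξ := by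
  refine ⟨fun x y h => ?_, fun x x' h => ?_, fun x x' z h h1 h2 => ?_⟩
  · simp only [entry_combination, hσ.1 x y h, hτ.1 x y h]
  · have a := hσ.2.1 x x' h
    have b := hτ.2.1 x x' h
    simp only [entry_combination]
    constructor <;> linarith [a.1, a.2, b.1, b.2]
  · have a := hσ.2.2 x x' z h h1 h2
    have b := hτ.2.2 x x' z h h1 h2
    simp only [entry_combination]
    constructor <;> linarith [a.1, a.2, b.1, b.2]

/-- Moving a feasible point towards the constant matrix `1` gives slack against small changes of
the intermediate margins. -/
lemma combination_mem_turnoutSet {w : Pair A → ℝ} {σ : Pair A → ℝ} {ε : ℝ}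
    (hε1 : ε ≤ 1) [IsStrictTotalOrder A ξ] (hσ : σ ∈ turnoutSet v ξ)
    (hw1 : ∀ x x', IsNext ξ x x' → interMargin w ξ x x' ≤
      (1 - ε) * interMargin v ξ x x' + ε)
    (hw2 : ∀ x x', IsNext ξ x x' → (1 - ε) * interMargin v ξ x x' ≤ interMargin w ξ x x') :
    (fun p => (1 - ε) * σ p + ε * 1) ∈ turnoutSet w ξ := by
  have hc : ∀ x y : A, x ≠ y →
      entry (fun p => (1 - ε) * σ p + ε * 1) x y = (1 - ε) * entry σ x y + ε := by
    intro x y h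
    rw [entry_combination (1 - ε) ε σ (fun _ => 1), entry_one h, mul_one]
  have hε' : 0 ≤ 1 - ε := by linarith
  refine ⟨fun x y h => ?_, fun x x' h => ?_, fun x x' z h h1 h2 => ?_⟩
  · rw [hc x y h, hc y x h.symm, hσ.1 x y h]
  · have a := hσ.2.1 x x' h
    rw [hc x x' (ne_of_rel h.1)]
    have b1 := mul_le_mul_of_nonneg_left a.1 hε'
    have b2 := mul_le_mul_of_nonneg_left a.2 hε'
    constructor <;> linarith [hw1 x x' h]
  · have a := hσ.2.2 x x' z h h1 h2
    rw [hc x z h1.symm, hc x' z h2.symm]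
    have b1 := mul_nonneg hε' a.1
    have b2 := mul_le_mul_of_nonneg_left a.2 hε'
    constructor <;> linarith [hw2 x x' h]

lemma turnout_mem (hv : v ∈ Omega A) (p : Pair A) : turnout v p ∈ Icc (0 : ℝ) 1 :=
  ⟨add_nonneg (hv p).1.1 (hv p.rev).1.1, (hv p).2⟩

lemma continuous_turnout : Continuous (turnout : (Pair A → ℝ) → Pair A → ℝ) :=
  continuous_pi fun p => (continuous_apply p).add (continuous_apply p.rev)

variable [Fintype A]

lemma continuous_deviation : Continuous fun q : (Pair A → ℝ) × (Pair A → ℝ) =>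
    deviation q.1 q.2 := by
  unfold deviation
  refine continuous_finsetSum _ fun x _ => continuous_finsetSum _ fun y _ => ?_
  exact (((continuous_entry x y).comp continuous_snd).sub
    ((continuous_entry x y).comp continuous_fst)).pow 2

lemma sq_le_deviation (t τ : Pair A → ℝ) (p : Pair A) : (τ p - t p) ^ 2 ≤ deviation t τ := by
  classical
  rw [← entry_pair τ p, ← entry_pair t p]
  unfold deviation
  refine le_trans ?_ (Finset.single_le_sum (f := fun x => ∑ y ∈ Finset.univ.erase x,
    (entry τ x y - entry t x y) ^ 2)
    (fun x _ => Finset.sum_nonneg fun y _ => sq_nonneg _) (Finset.mem_univ p.1.1))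
  refine le_trans ?_ (Finset.single_le_sum (f := fun y => (entry τ p.1.1 y - entry t p.1.1 y) ^ 2)
    (fun y _ => sq_nonneg _) (a := p.1.2) ?_)
  · exact le_rfl
  · simpa using p.2.symm

/-- Parallelogram identity; the last term is the strict convexity behind uniqueness. -/
lemma deviation_midpoint (t σ τ : Pair A → ℝ) :
    deviation t (fun p => (1 / 2 : ℝ) * σ p + (1 / 2 : ℝ) * τ p) =
      (deviation t σ + deviation t τ) / 2 - deviation σ τ / 4 := by
  simp only [deviation, entry_combination, Finset.sum_div, ← Finset.sum_add_distrib,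
    ← Finset.sum_sub_distrib]
  refine Finset.sum_congr rfl fun x _ => Finset.sum_congr rfl fun y _ => ?_
  ring

lemma IsInterTurnout.unique {σ τ : Pair A → ℝ} (hσ : IsInterTurnout v ξ σ)
    (hτ : IsInterTurnout v ξ τ) : σ = τ := by
  have h1 := hσ.2 _ (midpoint_mem_turnoutSet hσ.1 hτ.1)
  have h2 := hτ.2 _ hσ.1
  rw [deviation_midpoint] at h1
  funext p
  have h3 := sq_le_deviation σ τ p
  have h4 : (τ p - σ p) ^ 2 = 0 := le_antisymm (by linarith) (sq_nonneg _)
  have := pow_eq_zero_iff (two_ne_zero) |>.1 h4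
  linarith

lemma deviation_one_le (hv : v ∈ Omega A) :
    deviation (turnout v) (fun _ => 1) ≤ (Fintype.card A : ℝ) ^ 2 := by
  classical
  unfold deviation
  have h1 : ∀ x : A, ∑ y ∈ Finset.univ.erase x,
      (entry (fun _ => (1 : ℝ)) x y - entry (turnout v) x y) ^ 2 ≤ (Fintype.card A : ℝ) := by
    intro x
    refine (Finset.sum_le_card_nsmul _ _ 1 fun y hy => ?_).trans ?_
    · have hxy : x ≠ y := (Finset.ne_of_mem_erase hy).symm
      rw [entry_one hxy, entry_of_ne _ hxy]
      have := turnout_mem hv ⟨(x, y), hxy⟩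
      rw [sq_le_one_iff_abs_le_one, abs_le]
      constructor <;> linarith [this.1, this.2]
    · rw [nsmul_eq_mul, mul_one]
      exact_mod_cast Finset.card_le_univ _
  refine (Finset.sum_le_card_nsmul _ _ _ fun x _ => h1 x).trans ?_
  rw [nsmul_eq_mul, sq]
  exact le_rfl

/-- A compact box that contains all the points not farther from the turnouts than the constant
matrix `1`. -/
def turnoutBox (A : Type*) [Fintype A] : Set (Pair A → ℝ) :=
  Set.pi univ fun _ => Icc (-(Fintype.card A : ℝ) - 1) (Fintype.card A + 1)

lemma isCompact_turnoutBox : IsCompact (turnoutBox A) :=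
  isCompact_univ_pi fun _ => isCompact_Icc

lemma mem_turnoutBox (hv : v ∈ Omega A) {τ : Pair A → ℝ}
    (h : deviation (turnout v) τ ≤ deviation (turnout v) (fun _ => 1)) : τ ∈ turnoutBox A := by
  intro p _
  have h1 := abs_le_of_sq_le_sq' (((sq_le_deviation (turnout v) τ p).trans h).trans
    (deviation_one_le hv)) (Nat.cast_nonneg _)
  have h2 := turnout_mem hv p
  constructor <;> linarith [h1.1, h1.2, h2.1, h2.2]

/-- The constant matrix 1 is a feasible competitor. Points doing at least as well lie in a compact
box, and all other points lose to it. -/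
lemma exists_isInterTurnout (hv : v ∈ Omega A) (hξ : IsAdmissible v ξ) :
    ∃ τ, IsInterTurnout v ξ τ := by
  have h1 := one_mem_turnoutSet hv hξ
  obtain ⟨τ, hτ, hmin⟩ := (isCompact_turnoutBox.inter_right
    (isClosed_turnoutSet (v := v) (ξ := ξ))).exists_isMinOn
    ⟨_, mem_turnoutBox hv le_rfl, h1⟩
    (continuous_deviation.comp (Continuous.prodMk_right (turnout v))).continuousOn
  refine ⟨τ, hτ.2, fun σ hσ => ?_⟩
  rcases le_total (deviation (turnout v) σ) (deviation (turnout v) fun _ => 1) with h | h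
  · exact hmin ⟨mem_turnoutBox hv h, hσ⟩
  · exact (hmin ⟨mem_turnoutBox hv le_rfl, h1⟩).trans h

end Turnouts

/-! ### Independence of the admissible order -/

section Swap

variable {A : Type*} {ξ : A → A → Prop} {v : Pair A → ℝ} {a b : A}

open Classical in
/-- The relation obtained from `ξ` by interchanging the roles of `a` and `b`. -/
def swapRel (ξ : A → A → Prop) (a b : A) : A → A → Prop :=
  fun x y => ξ (Equiv.swap a b x) (Equiv.swap a b y)

lemma isStrictTotalOrder_swapRel (ξ : A → A → Prop) [IsStrictTotalOrder A ξ] (a b : A) :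
    IsStrictTotalOrder A (swapRel ξ a b) := by
  classical
  refine isStrictTotalOrder_of (fun x => irrefl_of ξ _) (fun x y z h h' =>
    _root_.trans (r := ξ) h h') ?_
  intro x y h
  rcases trichotomous_of ξ (Equiv.swap a b x) (Equiv.swap a b y) with h1 | h1 | h1
  · exact Or.inl h1
  · exact absurd ((Equiv.swap a b).injective h1) h
  · exact Or.inr h1

lemma IsNext.rel_right_iff [IsStrictTotalOrder A ξ] (hab : IsNext ξ a b) {y : A} (hy : y ≠ b) :
    ξ a y ↔ ξ b y := by
  constructor
  · intro h
    rcases hab.weak_of_rel h with h1 | h1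
    · exact absurd h1.symm hy
    · exact h1
  · exact fun h => _root_.trans hab.1 h

lemma IsNext.rel_left_iff [IsStrictTotalOrder A ξ] (hab : IsNext ξ a b) {x : A} (hx : x ≠ a) :
    ξ x b ↔ ξ x a := by
  constructor
  · intro h
    rcases hab.weak_of_rel' h with h1 | h1
    · exact absurd h1 hx
    · exact h1
  · exact fun h => _root_.trans h hab.1

lemma IsNext.swap_rel_swap [IsStrictTotalOrder A ξ] (hab : IsNext ξ a b) {x y : A}
    (h : ξ x y) (hne : ¬ (x = a ∧ y = b)) : swapRel ξ a b x y := by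
  classical
  have nab := ne_of_rel hab.1
  have nxy := ne_of_rel h
  unfold swapRel
  by_cases hxa : x = a
  · subst hxa
    have hyb : y ≠ b := fun h => hne ⟨rfl, h⟩
    rw [Equiv.swap_apply_left, Equiv.swap_apply_of_ne_of_ne nxy.symm hyb]
    exact (hab.rel_right_iff hyb).1 h
  by_cases hxb : x = b
  · subst hxb
    have hya : y ≠ a := by rintro rfl; exact not_rel_of_rel h hab.1
    rw [Equiv.swap_apply_right, Equiv.swap_apply_of_ne_of_ne hya nxy.symm]
    exact (hab.rel_right_iff nxy.symm).2 h
  rw [Equiv.swap_apply_of_ne_of_ne hxa hxb]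
  by_cases hya : y = a
  · subst hya
    rw [Equiv.swap_apply_left]
    exact (hab.rel_left_iff hxa).2 h
  by_cases hyb : y = b
  · subst hyb
    rw [Equiv.swap_apply_right]
    exact (hab.rel_left_iff hxa).1 h
  rwa [Equiv.swap_apply_of_ne_of_ne hya hyb]

lemma swapRel_swapRel (ξ : A → A → Prop) (a b : A) : swapRel (swapRel ξ a b) b a = ξ := by
  classical
  funext x y
  simp [swapRel, Equiv.swap_comm b a]

open Classical in
lemma isNext_swapRel_iff {x y : A} :
    IsNext (swapRel ξ a b) x y ↔
      IsNext ξ (Equiv.swap a b x) (Equiv.swap a b y) := by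
  refine and_congr Iff.rfl ⟨fun h z hz => h (Equiv.swap a b z) ?_, fun h z hz => h _ hz⟩
  simpa [swapRel] using hz

lemma IsNext.swapRel (hab : IsNext ξ a b) : IsNext (swapRel ξ a b) b a := by
  classical
  rw [isNext_swapRel_iff]
  simpa using hab

lemma IsNext.swap_rel_of_swapRel [IsStrictTotalOrder A ξ] (hab : IsNext ξ a b) {x y : A}
    (h : CLC.swapRel ξ a b x y) (hne : ¬ (x = b ∧ y = a)) : ξ x y := by
  have := isStrictTotalOrder_swapRel ξ a b
  have := hab.swapRel.swap_rel_swap h hne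
  rwa [swapRel_swapRel] at this

lemma IsAdmissible.swapRel (hξ : IsAdmissible v ξ) (hab : IsNext ξ a b)
    (h0 : indirectMargin v a b = 0) : IsAdmissible v (swapRel ξ a b) := by
  have := hξ.1
  refine ⟨isStrictTotalOrder_swapRel ξ a b, fun x y h => hab.swap_rel_swap (hξ.2 x y h) ?_⟩
  rintro ⟨rfl, rfl⟩
  exact h.ne' h0

open Classical in
lemma weak_swapRel_iff {x y : A} :
    Weak (swapRel ξ a b) x y ↔
      Weak ξ (Equiv.swap a b x) (Equiv.swap a b y) := by
  exact or_congr (Equiv.swap a b).injective.eq_iff.symm Iff.rfl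

lemma IsNext.weak_right_iff [IsStrictTotalOrder A ξ] (hab : IsNext ξ a b) {y : A} (hy : y ≠ a) :
    Weak ξ a y ↔ Weak ξ b y := by
  refine ⟨?_, fun h => Or.inr (Weak.rel_trans hab.1 h)⟩
  rintro (h | h)
  · exact absurd h.symm hy
  · exact hab.weak_of_rel h

lemma IsNext.weak_left_iff [IsStrictTotalOrder A ξ] (hab : IsNext ξ a b) {x : A} (hx : x ≠ b) :
    Weak ξ x b ↔ Weak ξ x a := by
  refine ⟨?_, fun h => Or.inr (h.trans_rel hab.1)⟩
  rintro (h | h)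
  · exact absurd h hx
  · exact hab.weak_of_rel' h

lemma IsNext.eq_right [IsStrictTotalOrder A ξ] {x y : A} (hab : IsNext ξ a b)
    (h : IsNext ξ x y) (hx : x = a) : y = b := by
  subst hx
  rcases hab.weak_of_rel h.1 with h1 | h1
  · exact h1.symm
  · exact absurd ⟨hab.1, h1⟩ (h.2 b)

lemma IsNext.eq_left [IsStrictTotalOrder A ξ] {x y : A} (hab : IsNext ξ a b)
    (h : IsNext ξ x y) (hy : y = b) : x = a := by
  subst hy
  rcases hab.weak_of_rel' h.1 with h1 | h1
  · exact h1
  · exact absurd ⟨h1, hab.1⟩ (h.2 a)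

open Classical in
lemma IsNext.weak_swap_left [IsStrictTotalOrder A ξ] (hab : IsNext ξ a b) {y : A} (hy : y ≠ a)
    (p : A) : Weak ξ (Equiv.swap a b p) y ↔ Weak ξ p y := by
  by_cases h1 : p = a
  · subst h1
    rw [Equiv.swap_apply_left, hab.weak_right_iff hy]
  by_cases h2 : p = b
  · subst h2
    rw [Equiv.swap_apply_right, hab.weak_right_iff hy]
  rw [Equiv.swap_apply_of_ne_of_ne h1 h2]

open Classical in
lemma IsNext.weak_swap_right [IsStrictTotalOrder A ξ] (hab : IsNext ξ a b) {x : A} (hx : x ≠ b)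
    (p : A) : Weak ξ x (Equiv.swap a b p) ↔ Weak ξ x p := by
  by_cases h1 : p = a
  · subst h1
    rw [Equiv.swap_apply_left, hab.weak_left_iff hx]
  by_cases h2 : p = b
  · subst h2
    rw [Equiv.swap_apply_right, hab.weak_left_iff hx]
  rw [Equiv.swap_apply_of_ne_of_ne h1 h2]

open Classical in
/-- The intermediate margins of consecutive options depend only on the cut of the order. -/
lemma interMargin_swapRel [Finite A] (hξ : IsAdmissible v ξ) (hab : IsNext ξ a b)
    (h0 : indirectMargin v a b = 0) {x y : A} (h : IsNext (swapRel ξ a b) x y) :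
    interMargin v (swapRel ξ a b) x y =
      interMargin v ξ (Equiv.swap a b x)
        (Equiv.swap a b y) := by
  have := hξ.1
  have h' := isNext_swapRel_iff.1 h
  by_cases hxa : Equiv.swap a b x = a
  · have hyb := hab.eq_right h' hxa
    simp only [hxa, hyb]
    rw [hξ.interMargin_eq_zero hab.1 h0]
    have hx : x = b := by
      rw [← Equiv.swap_apply_left a b] at hxa; simpa [Equiv.swap_apply_eq_iff] using hxa
    have hy : y = a := by
      rw [← Equiv.swap_apply_right a b] at hyb; simpa [Equiv.swap_apply_eq_iff] using hyb
    subst hx hy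
    refine (hξ.swapRel hab h0).interMargin_eq_zero h.1 ?_
    rw [indirectMargin_neg, h0, neg_zero]
  -- For any other link, `a` and `b` lie on the same side of the cut, so the predecessors and the
  -- successors that enter the infimum are unchanged by the transposition.
  · have hyb : Equiv.swap a b y ≠ b := fun h1 => hxa (hab.eq_left h' h1)
    unfold interMargin
    congr 1
    ext r
    have e1 : ∀ p, Weak (swapRel ξ a b) p x ↔ Weak ξ p (Equiv.swap a b x) := fun p => by
      rw [weak_swapRel_iff]; exact hab.weak_swap_left hxa p
    have e2 : ∀ p, Weak (swapRel ξ a b) y p ↔ Weak ξ (Equiv.swap a b y) p := fun p => by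
      rw [weak_swapRel_iff]; exact hab.weak_swap_right hyb p
    simp only [e1, e2]

open Classical in
/-- Feasible turnouts take equal values on `a` and `b` when their intermediate margin vanishes. -/
lemma entry_swap [Finite A] (hξ : IsAdmissible v ξ) (hab : IsNext ξ a b)
    (h0 : indirectMargin v a b = 0) {τ : Pair A → ℝ} (hτ : τ ∈ turnoutSet v ξ) {x y : A}
    (hxy : x ≠ y) :
    entry τ (Equiv.swap a b x) (Equiv.swap a b y) =
      entry τ x y := by
  have := hξ.1
  have nab := ne_of_rel hab.1
  have key : ∀ z, z ≠ a → z ≠ b → entry τ a z = entry τ b z := by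
    intro z h1 h2
    have := hτ.2.2 a b z hab h1 h2
    rw [hξ.interMargin_eq_zero hab.1 h0] at this
    linarith [this.1, this.2]
  have key' : ∀ z, z ≠ a → z ≠ b → entry τ z a = entry τ z b := by
    intro z h1 h2
    rw [hτ.1 z a h1, hτ.1 z b h2, key z h1 h2]
  by_cases hxa : x = a
  · subst hxa
    rw [Equiv.swap_apply_left]
    by_cases hyb : y = b
    · subst hyb
      rw [Equiv.swap_apply_right]
      exact hτ.1 _ _ hxy.symm
    · rw [Equiv.swap_apply_of_ne_of_ne hxy.symm hyb]
      exact (key y hxy.symm hyb).symm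
  by_cases hxb : x = b
  · subst hxb
    rw [Equiv.swap_apply_right]
    by_cases hya : y = a
    · subst hya
      rw [Equiv.swap_apply_left]
      exact hτ.1 _ _ hxy.symm
    · rw [Equiv.swap_apply_of_ne_of_ne hya hxy.symm]
      exact key y hya hxy.symm
  rw [Equiv.swap_apply_of_ne_of_ne hxa hxb]
  by_cases hya : y = a
  · subst hya
    rw [Equiv.swap_apply_left]
    exact (key' x hxa hxb).symm
  by_cases hyb : y = b
  · subst hyb
    rw [Equiv.swap_apply_right]
    exact key' x hxa hxb
  rw [Equiv.swap_apply_of_ne_of_ne hya hyb]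

lemma turnoutSet_subset_swapRel [Finite A] (hξ : IsAdmissible v ξ) (hab : IsNext ξ a b)
    (h0 : indirectMargin v a b = 0) : turnoutSet v ξ ⊆ turnoutSet v (swapRel ξ a b) := by
  classical
  have := hξ.1
  intro τ hτ
  have es := fun {x y : A} (h : x ≠ y) => entry_swap hξ hab h0 hτ h
  have inj := (Equiv.swap a b).injective
  have nne := isStrictTotalOrder_swapRel ξ a b
  refine ⟨hτ.1, fun x x' h => ?_, fun x x' z h h1 h2 => ?_⟩
  · rw [interMargin_swapRel hξ hab h0 h, ← es (ne_of_rel h.1)]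
    exact hτ.2.1 _ _ (isNext_swapRel_iff.1 h)
  · rw [interMargin_swapRel hξ hab h0 h, ← es h1.symm, ← es h2.symm]
    exact hτ.2.2 _ _ _ (isNext_swapRel_iff.1 h) (inj.ne h1) (inj.ne h2)

lemma turnoutSet_swapRel [Finite A] (hξ : IsAdmissible v ξ) (hab : IsNext ξ a b)
    (h0 : indirectMargin v a b = 0) : turnoutSet v (swapRel ξ a b) = turnoutSet v ξ := by
  refine Subset.antisymm ?_ (turnoutSet_subset_swapRel hξ hab h0)
  -- Transposing back turns the inclusion already proved into the reverse one.
  have h := turnoutSet_subset_swapRel (hξ.swapRel hab h0) hab.swapRel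
    (by rw [indirectMargin_neg, h0, neg_zero])
  rwa [swapRel_swapRel] at h

open Classical in
lemma gammaSet_swapRel [Finite A] (hξ : IsAdmissible v ξ) (hab : IsNext ξ a b)
    (h0 : indirectMargin v a b = 0) {τ : Pair A → ℝ} (hτ : τ ∈ turnoutSet v ξ) (x y : A) :
    gammaSet v (swapRel ξ a b) τ x y =
      gammaSet v ξ τ (Equiv.swap a b x)
        (Equiv.swap a b y) := by
  have := hξ.1
  have nne := isStrictTotalOrder_swapRel ξ a b
  ext r
  constructor
  · rintro ⟨p, p', h1, h2, h3, h4⟩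
    refine ⟨_, _, weak_swapRel_iff.1 h1, h2, isNext_swapRel_iff.1 h3, ?_⟩
    rwa [← interMargin_swapRel hξ hab h0 h3, entry_swap hξ hab h0 hτ (ne_of_rel h3.1)]
  · rintro ⟨p, p', h1, h2, h3, h4⟩
    have h3' : IsNext (swapRel ξ a b) (Equiv.swap a b p) (Equiv.swap a b p') := by
      rw [isNext_swapRel_iff]
      simpa using h3
    refine ⟨Equiv.swap a b p, Equiv.swap a b p', ?_, ?_, h3', ?_⟩
    · rw [weak_swapRel_iff]; simpa using h1
    · simpa [swapRel] using h2
    · rw [interMargin_swapRel hξ hab h0 h3', ← entry_swap hξ hab h0 hτ (ne_of_rel h3'.1)]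
      simpa using h4

/-- The interval of the link `ab` is a single point. With `c` the successor of `b`, the constraints
give `τ_ac = τ_bc` and `0 ≤ τ_ab - τ_ac ≤ m_bc`, so this point lies in the interval of `bc` and adds
nothing to the union. -/
lemma gammaSet_left_eq [Finite A] (hξ : IsAdmissible v ξ) (hab : IsNext ξ a b)
    (h0 : indirectMargin v a b = 0) {τ : Pair A → ℝ} (hτ : τ ∈ turnoutSet v ξ) {y : A}
    (hy : ξ b y) : gammaSet v ξ τ a y = gammaSet v ξ τ b y := by
  classical
  have := hξ.1
  ext r
  constructor
  · rintro ⟨p, p', h1, h2, h3, h4⟩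
    by_cases hp : p = a
    · have hp' := hab.eq_right h3 hp
      subst hp hp'
      obtain ⟨c, hc⟩ := exists_isNext hy
      refine ⟨p', c, Or.inl rfl, hy, hc, ?_⟩
      have nac : p ≠ c := ne_of_rel (_root_.trans h3.1 hc.1)
      have e1 := hτ.2.2 p' c p hc (ne_of_rel h3.1) nac
      have e2 := hτ.2.2 p p' c h3 nac.symm (ne_of_rel hc.1).symm
      rw [hξ.interMargin_eq_zero h3.1 h0] at h4 e2
      rw [hτ.1 p' p (ne_of_rel h3.1).symm, hτ.1 c p nac.symm] at e1
      constructor <;> linarith [e1.1, e1.2, e2.1, e2.2, h4.1, h4.2]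
    · exact ⟨p, p', (hab.weak_right_iff hp).1 h1, h2, h3, h4⟩
  · rintro ⟨p, p', h1, h2, h3, h4⟩
    exact ⟨p, p', Or.inr (Weak.rel_trans hab.1 h1), h2, h3, h4⟩

lemma gammaSet_right_eq [Finite A] (hξ : IsAdmissible v ξ) (hab : IsNext ξ a b)
    (h0 : indirectMargin v a b = 0) {τ : Pair A → ℝ} (hτ : τ ∈ turnoutSet v ξ) {x : A}
    (hx : ξ x a) : gammaSet v ξ τ x b = gammaSet v ξ τ x a := by
  classical
  have := hξ.1
  ext r
  constructor
  · rintro ⟨p, p', h1, h2, h3, h4⟩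
    by_cases hp : p = a
    · have hp' := hab.eq_right h3 hp
      subst hp hp'
      obtain ⟨c, hc⟩ := exists_isNext' hx
      refine ⟨c, p, hc.weak_of_rel' hx, hc.1, hc, ?_⟩
      have nac : p' ≠ c := (ne_of_rel (_root_.trans hc.1 h3.1)).symm
      have e1 := hτ.2.2 c p p' hc nac (ne_of_rel h3.1).symm
      have e2 := hτ.2.2 p p' c h3 (ne_of_rel hc.1) nac.symm
      rw [hξ.interMargin_eq_zero h3.1 h0] at h4 e2
      rw [hτ.1 c p' nac.symm] at e1
      rw [hτ.1 p c (ne_of_rel hc.1).symm] at e2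
      constructor <;> linarith [e1.1, e1.2, e2.1, e2.2, h4.1, h4.2]
    · exact ⟨p, p', h1, (hab.rel_left_iff hp).1 h2, h3, h4⟩
  · rintro ⟨p, p', h1, h2, h3, h4⟩
    exact ⟨p, p', h1, _root_.trans h2 hab.1, h3, h4⟩

open Classical in
lemma gammaSet_swap_eq [Finite A] (hξ : IsAdmissible v ξ) (hab : IsNext ξ a b)
    (h0 : indirectMargin v a b = 0) {τ : Pair A → ℝ} (hτ : τ ∈ turnoutSet v ξ) {x y : A}
    (h : ξ x y) (hne : ¬ (x = a ∧ y = b)) :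
    gammaSet v ξ τ (Equiv.swap a b x) (Equiv.swap a b y) =
      gammaSet v ξ τ x y := by
  have := hξ.1
  have nxy := ne_of_rel h
  by_cases hxa : x = a
  · subst hxa
    have hyb : y ≠ b := fun h => hne ⟨rfl, h⟩
    rw [Equiv.swap_apply_left, Equiv.swap_apply_of_ne_of_ne nxy.symm hyb]
    exact (gammaSet_left_eq hξ hab h0 hτ ((hab.rel_right_iff hyb).1 h)).symm
  by_cases hxb : x = b
  · subst hxb
    have hya : y ≠ a := by rintro rfl; exact not_rel_of_rel h hab.1
    rw [Equiv.swap_apply_right, Equiv.swap_apply_of_ne_of_ne hya nxy.symm]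
    exact gammaSet_left_eq hξ hab h0 hτ h
  rw [Equiv.swap_apply_of_ne_of_ne hxa hxb]
  by_cases hya : y = a
  · subst hya
    rw [Equiv.swap_apply_left]
    exact gammaSet_right_eq hξ hab h0 hτ h
  by_cases hyb : y = b
  · subst hyb
    rw [Equiv.swap_apply_right]
    exact (gammaSet_right_eq hξ hab h0 hτ ((hab.rel_left_iff hxa).1 h)).symm
  rw [Equiv.swap_apply_of_ne_of_ne hya hyb]

/-- The only link from `a` to `b` has zero margin, so maximum and minimum coincide. The two scores
may thus exchange roles when `a` and `b` are transposed. -/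
lemma gammaSet_subsingleton [Finite A] (hξ : IsAdmissible v ξ) (hab : IsNext ξ a b)
    (h0 : indirectMargin v a b = 0) {τ : Pair A → ℝ} :
    (gammaSet v ξ τ a b).Subsingleton := by
  have := hξ.1
  have key : ∀ r ∈ gammaSet v ξ τ a b, r = entry τ a b / 2 := by
    rintro r ⟨p, p', h1, h2, h3, h4⟩
    have hp : p = a := by
      rcases h1 with rfl | h1
      · rfl
      · exact absurd ⟨h1, h2⟩ (hab.2 p)
    have hp' := hab.eq_right h3 hp
    subst hp hp'
    rw [hξ.interMargin_eq_zero h3.1 h0] at h4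
    linarith [h4.1, h4.2]
  intro r hr s hs
  rw [key r hr, key s hs]

variable [Fintype A]

lemma IsProjection.swapRel {s : Pair A → ℝ} (hs : IsProjection v ξ s) (hξ : IsAdmissible v ξ)
    (hab : IsNext ξ a b) (h0 : indirectMargin v a b = 0) :
    IsProjection v (swapRel ξ a b) s := by
  classical
  have := hξ.1
  obtain ⟨τ, hτ, hs⟩ := hs
  refine ⟨τ, ?_, fun x y hxy => ?_⟩
  · unfold IsInterTurnout
    rw [turnoutSet_swapRel hξ hab h0]
    exact hτ
  · rw [gammaSet_swapRel hξ hab h0 hτ.1]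
    by_cases h : x = b ∧ y = a
    · obtain ⟨rfl, rfl⟩ := h
      simp only [Equiv.swap_apply_left, Equiv.swap_apply_right]
      obtain ⟨h1, h2⟩ := hs y x hab.1
      have e := gammaSet_subsingleton hξ hab h0 h1.1 h2.1
      rw [e] at h1 ⊢
      exact ⟨h1, h2⟩
    · have h1 := hab.swap_rel_of_swapRel hxy h
      rw [gammaSet_swap_eq hξ hab h0 hτ.1 h1]
      · exact hs x y h1
      · rintro ⟨rfl, rfl⟩
        have : ξ y x := by simpa [CLC.swapRel] using hxy
        exact not_rel_of_rel hab.1 this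

/-- Two different total orders disagree on some pair of consecutive options. -/
lemma exists_isNext_inversion {η : A → A → Prop} [IsStrictTotalOrder A ξ] [IsStrictTotalOrder A η]
    {x y : A} (h : ξ x y) (h' : η y x) : ∃ a b, IsNext ξ a b ∧ η b a := by
  by_contra! hcon
  -- Induction runs downwards from the last option: agreement on consecutive pairs propagates by
  -- transitivity.
  have wf := Finite.wellFounded_of_trans_of_irrefl (Function.swap ξ)
  have key : ∀ x, ∀ y, ξ x y → η x y := by
    intro x
    induction x using wf.induction with
    | _ x ih =>
      intro y hxy
      obtain ⟨x', hx'⟩ := exists_isNext hxy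
      have h1 : η x x' := by
        rcases weak_of_not (hcon x x' hx') with h1 | h1
        · exact absurd h1 (ne_of_rel hx'.1)
        · exact h1
      rcases hx'.weak_of_rel hxy with rfl | h2
      · exact h1
      · exact _root_.trans h1 (ih x' hx'.1 y h2)
  exact not_rel_of_rel (key x y h) h'

/-- The projected scores do not depend on the admissible order. -/
lemma IsProjection.of_isAdmissible {s : Pair A → ℝ} {η : A → A → Prop} (hη : IsAdmissible v η)
    (hξ : IsAdmissible v ξ) (hs : IsProjection v ξ s) : IsProjection v η s := by
  classical
  have hη' := hη.1
  -- Bubble sort: the induction is on the number of inversions between the two orders.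
  induction hn : {q : A × A | ξ q.1 q.2 ∧ η q.2 q.1}.ncard using Nat.strong_induction_on
    generalizing ξ with
  | _ n ih =>
    subst hn
    have hξ' := hξ.1
    by_cases hne : ∃ x y, ξ x y ∧ η y x
    · obtain ⟨x, y, h1, h2⟩ := hne
      obtain ⟨a, b, hab, hba⟩ := exists_isNext_inversion h1 h2
      -- Each admissible order forces one sign of the margin, so an inverted pair is tied.
      have h0 : indirectMargin v a b = 0 := by
        have e1 := hξ.indirectMargin_nonneg hab.1
        have e2 := hη.indirectMargin_nonneg hba
        rw [indirectMargin_neg] at e2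
        linarith
      refine ih _ ?_ (hξ.swapRel hab h0) (hs.swapRel hξ hab h0) rfl
      refine Set.ncard_lt_ncard ⟨?_, fun hsub => ?_⟩ (Set.toFinite _)
      · rintro ⟨u, w⟩ ⟨h3, h4⟩
        refine ⟨hab.swap_rel_of_swapRel h3 ?_, h4⟩
        rintro ⟨rfl, rfl⟩
        exact not_rel_of_rel hba h4
      · have h5 := (hsub (show (a, b) ∈ _ from ⟨hab.1, hba⟩)).1
        have : ξ b a := by simpa [CLC.swapRel] using h5
        exact not_rel_of_rel hab.1 this
    · push Not at hne
      have : ξ = η := by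
        funext x y
        apply propext
        constructor
        · intro h
          rcases weak_of_not (hne x y h) with h1 | h1
          · exact absurd h1 (ne_of_rel h)
          · exact h1
        · intro h
          rcases weak_of_not (fun h' => hne y x h' h) with h1 | h1
          · exact absurd h1 (ne_of_rel h)
          · exact h1
      rwa [this] at hs

end Swap

/-! ### Existence and uniqueness of the projected scores -/

section Projection

variable {A : Type*} [Fintype A] {ξ : A → A → Prop} {v : Pair A → ℝ}

open Classical in
/-- The pairs of consecutive options between `x` and `y`. -/
noncomputable def links (ξ : A → A → Prop) (x y : A) : Finset (A × A) :=
  Finset.univ.filter fun q => Weak ξ x q.1 ∧ ξ q.1 y ∧ IsNext ξ q.1 q.2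

lemma mem_links {x y : A} {q : A × A} :
    q ∈ links ξ x y ↔ Weak ξ x q.1 ∧ ξ q.1 y ∧ IsNext ξ q.1 q.2 := by
  simp [links]

lemma links_nonempty [IsStrictTotalOrder A ξ] {x y : A} (h : ξ x y) : (links ξ x y).Nonempty := by
  obtain ⟨x', hx'⟩ := exists_isNext h
  exact ⟨(x, x'), mem_links.2 ⟨Or.inl rfl, h, hx'⟩⟩

lemma isGreatest_gammaSet (hξ : IsAdmissible v ξ) (τ : Pair A → ℝ) {x y : A}
    (hne : (links ξ x y).Nonempty) :
    IsGreatest (gammaSet v ξ τ x y) ((links ξ x y).sup' hne fun q =>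
      (entry τ q.1 q.2 + interMargin v ξ q.1 q.2) / 2) := by
  constructor
  · obtain ⟨q, hq, h⟩ := Finset.exists_mem_eq_sup' hne fun q : A × A =>
      (entry τ q.1 q.2 + interMargin v ξ q.1 q.2) / 2
    rw [h]
    obtain ⟨h1, h2, h3⟩ := mem_links.1 hq
    exact ⟨q.1, q.2, h1, h2, h3, by linarith [hξ.interMargin_nonneg h3.1], le_rfl⟩
  · rintro r ⟨p, p', h1, h2, h3, h4⟩
    exact h4.2.trans (Finset.le_sup' (fun q : A × A =>
      (entry τ q.1 q.2 + interMargin v ξ q.1 q.2) / 2) (show (p, p') ∈ links ξ x y from mem_links.2 ⟨h1, h2, h3⟩))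

lemma isLeast_gammaSet (hξ : IsAdmissible v ξ) (τ : Pair A → ℝ) {x y : A}
    (hne : (links ξ x y).Nonempty) :
    IsLeast (gammaSet v ξ τ x y) ((links ξ x y).inf' hne fun q =>
      (entry τ q.1 q.2 - interMargin v ξ q.1 q.2) / 2) := by
  constructor
  · obtain ⟨q, hq, h⟩ := Finset.exists_mem_eq_inf' hne fun q : A × A =>
      (entry τ q.1 q.2 - interMargin v ξ q.1 q.2) / 2
    rw [h]
    obtain ⟨h1, h2, h3⟩ := mem_links.1 hq
    exact ⟨q.1, q.2, h1, h2, h3, le_rfl, by linarith [hξ.interMargin_nonneg h3.1]⟩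
  · rintro r ⟨p, p', h1, h2, h3, h4⟩
    exact (Finset.inf'_le (fun q : A × A =>
      (entry τ q.1 q.2 - interMargin v ξ q.1 q.2) / 2)
      (show (p, p') ∈ links ξ x y from mem_links.2 ⟨h1, h2, h3⟩)).trans h4.1

lemma exists_isProjection (hv : v ∈ Omega A) (hξ : IsAdmissible v ξ) :
    ∃ s, IsProjection v ξ s := by
  have := hξ.1
  obtain ⟨τ, hτ⟩ := exists_isInterTurnout hv hξ
  have key : ∀ p : Pair A, ∃ r : ℝ,
      (ξ p.1.1 p.1.2 → IsGreatest (gammaSet v ξ τ p.1.1 p.1.2) r) ∧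
      (ξ p.1.2 p.1.1 → IsLeast (gammaSet v ξ τ p.1.2 p.1.1) r) := by
    intro p
    by_cases h : ξ p.1.1 p.1.2
    · exact ⟨_, fun _ => isGreatest_gammaSet hξ τ (links_nonempty h),
        fun h' => absurd h' (not_rel_of_rel h)⟩
    · by_cases h' : ξ p.1.2 p.1.1
      · exact ⟨_, fun h'' => absurd h'' h, fun _ => isLeast_gammaSet hξ τ (links_nonempty h')⟩
      -- Arbitrary value: totality of the order excludes this case.
      · exact ⟨0, fun h'' => absurd h'' h, fun h'' => absurd h'' h'⟩
  choose s hs using key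
  refine ⟨s, τ, hτ, fun x y h => ?_⟩
  rw [entry_of_ne s (ne_of_rel h), entry_of_ne s (ne_of_rel h).symm]
  exact ⟨(hs ⟨(x, y), _⟩).1 h, (hs ⟨(y, x), _⟩).2 h⟩

lemma IsProjection.unique {s s' : Pair A → ℝ} (hξ : IsAdmissible v ξ) (hs : IsProjection v ξ s)
    (hs' : IsProjection v ξ s') : s = s' := by
  have := hξ.1
  obtain ⟨τ, hτ, hs⟩ := hs
  obtain ⟨τ', hτ', hs'⟩ := hs'
  obtain rfl := hτ.unique hτ'
  funext p
  rw [← entry_pair s, ← entry_pair s']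
  rcases trichotomous_of ξ p.1.1 p.1.2 with h | h | h
  · exact (hs _ _ h).1.unique (hs' _ _ h).1
  · exact absurd h p.2
  · exact (hs _ _ h).2.unique (hs' _ _ h).2

/-- The choice operator only provides some admissible order; independence of the order transfers the
result to the given one. -/
lemma isProjection_projectedScores (hv : v ∈ Omega A) (hξ : IsAdmissible v ξ) :
    IsProjection v ξ (projectedScores v) := by
  have h : ∃ s, ∃ ξ : A → A → Prop, IsAdmissible v ξ ∧ IsProjection v ξ s := by
    obtain ⟨s, hs⟩ := exists_isProjection hv hξ
    exact ⟨s, ξ, hξ, hs⟩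
  obtain ⟨η, hη, hs⟩ := Classical.epsilon_spec h
  exact hs.of_isAdmissible hξ hη

lemma isProjection_iff (hv : v ∈ Omega A) (hξ : IsAdmissible v ξ) (s : Pair A → ℝ) :
    IsProjection v ξ s ↔ s = projectedScores v := by
  have h := isProjection_projectedScores hv hξ
  refine ⟨fun hs => hs.unique hξ h, ?_⟩
  rintro rfl
  exact h

end Projection

/-! ### Continuity in the Llull matrix -/

section Continuity

open Filter Topology

variable {A : Type*} [Fintype A]

/-- The Llull matrices for which `ξ` is admissible. -/
def admissibleSet (ξ : A → A → Prop) : Set (Pair A → ℝ) := {v | v ∈ Omega A ∧ IsAdmissible v ξ}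

lemma isClosed_admissibleSet (ξ : A → A → Prop) : IsClosed (admissibleSet ξ) := by
  by_cases hξ : IsStrictTotalOrder A ξ
  · have h : admissibleSet ξ = Omega A ∩ ⋂ (x : A) (y : A) (_ : ξ x y),
        Omega A ∩ (fun v => indirectMargin v x y) ⁻¹' Ici 0 := by
      ext v
      simp only [admissibleSet, isAdmissible_iff, mem_inter_iff, mem_iInter, mem_preimage, mem_Ici,
        mem_ofPred_eq]
      exact ⟨fun h => ⟨h.1, fun x y hxy => ⟨h.1, h.2 x y hxy⟩⟩,
        fun h => ⟨h.1, fun x y hxy => (h.2 x y hxy).2⟩⟩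
    rw [h]
    exact isClosed_omega.inter <| isClosed_iInter fun x => isClosed_iInter fun y =>
      isClosed_iInter fun _ =>
        (continuousOn_indirectMargin x y).preimage_isClosed_of_isClosed isClosed_omega isClosed_Ici
  · have h : admissibleSet ξ = ∅ := by
      ext v
      exact ⟨fun h => hξ h.2.1, fun h => h.elim⟩
    rw [h]
    exact isClosed_empty

/-- Lower semicontinuity of the set of feasible turnouts. -/
lemma eventually_combination_mem_turnoutSet {ξ : A → A → Prop} {v₀ : Pair A → ℝ}
    (hv₀ : v₀ ∈ admissibleSet ξ) {σ : Pair A → ℝ} (hσ : σ ∈ turnoutSet v₀ ξ) {ε : ℝ}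
    (hε : 0 < ε) (hε1 : ε ≤ 1) :
    ∀ᶠ v in 𝓝[admissibleSet ξ] v₀, (fun p => (1 - ε) * σ p + ε * 1) ∈ turnoutSet v ξ := by
  have := hv₀.2.1
  have hc : ∀ x y, Tendsto (fun v => interMargin v ξ x y) (𝓝[admissibleSet ξ] v₀)
      (𝓝 (interMargin v₀ ξ x y)) := fun x y =>
    ((continuousOn_interMargin ξ x y) v₀ hv₀.1).mono_left (nhdsWithin_mono _ fun v hv => hv.1)
  have h1 : ∀ x x', IsNext ξ x x' → ∀ᶠ v in 𝓝[admissibleSet ξ] v₀,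
      interMargin v ξ x x' ≤ (1 - ε) * interMargin v₀ ξ x x' + ε := by
    intro x x' _
    -- If the limit margin is below 1, the combination leaves strict room; if it equals 1, the
    -- universal bound 1 is enough.
    rcases (interMargin_le_one (ξ := ξ) hv₀.1 x x').eq_or_lt with h | h
    · filter_upwards [self_mem_nhdsWithin] with v hv
      have := interMargin_le_one (ξ := ξ) hv.1 x x'
      rw [h]
      linarith
    · refine (hc x x').eventually_le_const ?_
      nlinarith
  have h2 : ∀ x x', IsNext ξ x x' → ∀ᶠ v in 𝓝[admissibleSet ξ] v₀,
      (1 - ε) * interMargin v₀ ξ x x' ≤ interMargin v ξ x x' := by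
    intro x x' hx
    -- A positive limit margin leaves room `ε` times itself. A zero one leaves none, and
    -- nonnegativity of nearby margins replaces it; this uses that `ξ` stays admissible.
    rcases (hv₀.2.interMargin_nonneg hx.1).eq_or_lt with h | h
    · filter_upwards [self_mem_nhdsWithin] with v hv
      rw [← h, mul_zero]
      exact hv.2.interMargin_nonneg hx.1
    · refine (hc x x').eventually_const_le ?_
      nlinarith
  simp only [← eventually_all] at h1 h2
  filter_upwards [h1, h2] with v h1 h2
  exact combination_mem_turnoutSet hε1 hσ h1 h2

/-- The minimizers depend continuously on the Llull matrix while a fixed order is admissible. -/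
lemma continuousOn_of_isInterTurnout {ξ : A → A → Prop} {f : (Pair A → ℝ) → Pair A → ℝ}
    (hf : ∀ v ∈ admissibleSet ξ, IsInterTurnout v ξ (f v)) : ContinuousOn f (admissibleSet ξ) := by
  intro v₀ hv₀
  have hsub : admissibleSet ξ ⊆ Omega A := fun v hv => hv.1
  -- In a compact box it suffices that every cluster point is a minimizer at `v₀`, by uniqueness of
  -- the minimizer.
  refine isCompact_turnoutBox.tendsto_nhds_of_unique_mapClusterPt ?_ fun τ _ hτ => ?_
  · filter_upwards [self_mem_nhdsWithin] with v hv
    exact mem_turnoutBox hv.1 ((hf v hv).2 _ (one_mem_turnoutSet hv.1 hv.2))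
  obtain ⟨U, hU, hUτ⟩ := mapClusterPt_iff_ultrafilter.1 hτ
  refine IsInterTurnout.unique ⟨?_, fun σ hσ => ?_⟩ (hf v₀ hv₀)
  · have hmem : ∀ᶠ v in (U : Filter (Pair A → ℝ)), f v ∈ turnoutSet v ξ :=
      hU (by filter_upwards [self_mem_nhdsWithin] with v hv using (hf v hv).1)
    have he : ∀ x y, Tendsto (fun v => entry (f v) x y) U (𝓝 (entry τ x y)) := fun x y =>
      ((continuous_entry x y).tendsto τ).comp hUτ
    have hm : ∀ x y, Tendsto (fun v => interMargin v ξ x y) U (𝓝 (interMargin v₀ ξ x y)) :=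
      fun x y => (((continuousOn_interMargin ξ x y) v₀ hv₀.1).mono_left
        (nhdsWithin_mono _ hsub)).mono_left hU
    refine ⟨fun x y h => ?_, fun x x' h => ⟨?_, ?_⟩, fun x x' z h h1 h2 => ⟨?_, ?_⟩⟩
    · exact tendsto_nhds_unique_of_eventuallyEq (he x y) (he y x)
        (hmem.mono fun v hv => hv.1 x y h)
    · exact le_of_tendsto_of_tendsto (hm x x') (he x x') (hmem.mono fun v hv => (hv.2.1 x x' h).1)
    · exact le_of_tendsto (he x x') (hmem.mono fun v hv => (hv.2.1 x x' h).2)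
    · exact ge_of_tendsto ((he x z).sub (he x' z))
        (hmem.mono fun v hv => (hv.2.2 x x' z h h1 h2).1)
    · exact le_of_tendsto_of_tendsto ((he x z).sub (he x' z)) (hm x x')
        (hmem.mono fun v hv => (hv.2.2 x x' z h h1 h2).2)
  · have ht : Tendsto turnout (U : Filter (Pair A → ℝ)) (𝓝 (turnout v₀)) :=
      (continuous_turnout.tendsto v₀).mono_left (hU.trans nhdsWithin_le_nhds)
    -- A competitor `σ` feasible at `v₀` may be infeasible nearby, so it is compared after being
    -- moved towards 1; then `ε` tends to 0.
    have key : ∀ ε : ℝ, 0 < ε → ε ≤ 1 → deviation (turnout v₀) τ ≤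
        deviation (turnout v₀) (fun p => (1 - ε) * σ p + ε * 1) := by
      intro ε hε hε1
      refine le_of_tendsto_of_tendsto
        ((continuous_deviation.tendsto (turnout v₀, τ)).comp (ht.prodMk_nhds hUτ))
        ((continuous_deviation.tendsto (turnout v₀, _)).comp
          (ht.prodMk_nhds tendsto_const_nhds)) (hU ?_)
      filter_upwards [self_mem_nhdsWithin,
        eventually_combination_mem_turnoutSet hv₀ hσ hε hε1] with v hv hvσ
      exact (hf v hv).2 _ hvσ
    have hseg : Continuous fun (ε : ℝ) (p : Pair A) => (1 - ε) * σ p + ε * 1 :=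
      continuous_pi fun p => by fun_prop
    have hcont := (continuous_deviation.comp (Continuous.prodMk_right (turnout v₀))).comp hseg
    have hlim := (hcont.tendsto 0).mono_left (nhdsWithin_le_nhds (s := Ioi 0))
    simp only [Function.comp_apply, sub_zero, one_mul, zero_mul, add_zero] at hlim
    refine ge_of_tendsto hlim ?_
    filter_upwards [Ioc_mem_nhdsGT (zero_lt_one' ℝ)] with ε hε using key ε hε.1 hε.2

lemma continuousOn_projectedScores_admissibleSet (ξ : A → A → Prop) (p : Pair A) :
    ContinuousOn (fun v => projectedScores v p) (admissibleSet ξ) := by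
  classical
  by_cases hξ : IsStrictTotalOrder A ξ
  swap
  · intro v hv
    exact absurd hv.2.1 hξ
  have h : ∀ v, ∃ τ, v ∈ admissibleSet ξ → IsInterTurnout v ξ τ ∧
      ∀ x y : A, ξ x y →
      IsGreatest (gammaSet v ξ τ x y) (entry (projectedScores v) x y) ∧
      IsLeast (gammaSet v ξ τ x y) (entry (projectedScores v) y x) := by
    intro v
    by_cases hv : v ∈ admissibleSet ξ
    · obtain ⟨τ, hτ⟩ := isProjection_projectedScores hv.1 hv.2
      exact ⟨τ, fun _ => hτ⟩
    · exact ⟨0, fun h => absurd h hv⟩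
  choose f hf using h
  have hfc := continuousOn_of_isInterTurnout fun v hv => (hf v hv).1
  have he : ∀ x y, ContinuousOn (fun v => entry (f v) x y) (admissibleSet ξ) := fun x y =>
    (continuous_entry x y).comp_continuousOn hfc
  have hm : ∀ x y, ContinuousOn (fun v => interMargin v ξ x y) (admissibleSet ξ) := fun x y =>
    (continuousOn_interMargin ξ x y).mono fun v hv => hv.1
  rcases trichotomous_of ξ p.1.1 p.1.2 with h | h | h
  · have hne := links_nonempty h
    refine (ContinuousOn.finset_sup'_apply hne (f := fun q v =>
      (entry (f v) q.1 q.2 + interMargin v ξ q.1 q.2) / 2) fun q _ =>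
        ((he q.1 q.2).add (hm q.1 q.2)).div_const 2).congr fun v hv => ?_
    have := ((hf v hv).2 _ _ h).1.unique (isGreatest_gammaSet hv.2 (f v) hne)
    rwa [entry_pair] at this
  · exact absurd h p.2
  · have hne := links_nonempty h
    refine (ContinuousOn.finset_inf'_apply hne (f := fun q v =>
      (entry (f v) q.1 q.2 - interMargin v ξ q.1 q.2) / 2) fun q _ =>
        ((he q.1 q.2).sub (hm q.1 q.2)).div_const 2).congr fun v hv => ?_
    have := ((hf v hv).2 _ _ h).2.unique (isLeast_gammaSet hv.2 (f v) hne)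
    rwa [entry_pair] at this

lemma continuousOn_projectedScores (p : Pair A) :
    ContinuousOn (fun v => projectedScores v p) (Omega A) := by
  have h : Omega A = ⋃ ξ : A → A → Prop, admissibleSet ξ := by
    ext v
    rw [mem_iUnion]
    refine ⟨fun hv => ?_, fun ⟨ξ, hv⟩ => hv.1⟩
    obtain ⟨ξ, hξ⟩ := exists_isAdmissible hv
    exact ⟨ξ, hv, hξ⟩
  rw [h]
  -- Pasting over a finite closed cover; order independence lets one function serve all the pieces.
  exact (locallyFinite_of_finite _).continuousOn_iUnion isClosed_admissibleSet
    fun ξ => continuousOn_projectedScores_admissibleSet ξ p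

lemma continuousOn_rankLikeRate (x : A) :
    ContinuousOn (fun v => rankLikeRate v x) (Omega A) := by
  classical
  unfold rankLikeRate
  refine continuousOn_const.sub (continuousOn_finsetSum _ fun y hy => ?_)
  have hxy : x ≠ y := (Finset.ne_of_mem_erase hy).symm
  simp only [entry_of_ne _ hxy]
  exact continuousOn_projectedScores _

end Continuity

/-! ### Continuity in the frequencies of votes -/

section Frequencies

open Filter Topology

variable {K : Type*}

lemma summable_mul_of_mem_frequencies {α g : K → ℝ} (hα : α ∈ Frequencies K)
    (hg : ∀ k, g k ∈ Icc (0 : ℝ) 1) : Summable fun k => α k * g k :=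
  Summable.of_nonneg_of_le (fun k => mul_nonneg (hα.1 k) (hg k).1)
    (fun k => mul_le_of_le_one_right (hα.1 k) (hg k).2) hα.2.summable

/-- Lower semicontinuity: a finite partial sum already exceeds `r`, it is continuous coordinatewise,
and the remaining terms are nonnegative. -/
lemma eventually_lt_tsum_mul {α₀ g : K → ℝ} (hα₀ : α₀ ∈ Frequencies K)
    (hg : ∀ k, g k ∈ Icc (0 : ℝ) 1) {r : ℝ} (hr : r < ∑' k, α₀ k * g k) :
    ∀ᶠ α in 𝓝[Frequencies K] α₀, r < ∑' k, α k * g k := by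
  obtain ⟨F, hF⟩ := ((summable_mul_of_mem_frequencies hα₀ hg).hasSum.eventually_const_lt hr).exists
  have hc : Continuous fun α : K → ℝ => ∑ k ∈ F, α k * g k :=
    continuous_finsetSum _ fun k _ => (continuous_apply k).mul continuous_const
  filter_upwards [self_mem_nhdsWithin,
    nhdsWithin_le_nhds ((hc.tendsto α₀).eventually_const_lt hF)] with α hα h
  exact h.trans_le ((summable_mul_of_mem_frequencies hα hg).sum_le_tsum F
    fun k _ => mul_nonneg (hα.1 k) (hg k).1)

/-- Weighted means with bounded values are continuous for coordinatewise convergence of the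
weights. -/
lemma continuousOn_tsum_mul {g : K → ℝ} (hg : ∀ k, g k ∈ Icc (0 : ℝ) 1) :
    ContinuousOn (fun α : K → ℝ => ∑' k, α k * g k) (Frequencies K) := by
  intro α₀ hα₀
  -- Since the weights sum to 1, upper semicontinuity is lower semicontinuity for `1 - g`.
  have hg' : ∀ k, 1 - g k ∈ Icc (0 : ℝ) 1 := fun k =>
    ⟨sub_nonneg.2 (hg k).2, sub_le_self _ (hg k).1⟩
  have hsum : ∀ α ∈ Frequencies K, ∑' k, α k * (1 - g k) = 1 - ∑' k, α k * g k := by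
    intro α hα
    simp only [mul_sub, mul_one]
    rw [hα.2.summable.tsum_sub (summable_mul_of_mem_frequencies hα hg), hα.2.tsum_eq]
  refine tendsto_order.2 ⟨fun r hr => eventually_lt_tsum_mul hα₀ hg hr, fun r hr => ?_⟩
  have h : 1 - r < ∑' k, α₀ k * (1 - g k) := by
    rw [hsum α₀ hα₀]
    linarith
  filter_upwards [self_mem_nhdsWithin, eventually_lt_tsum_mul hα₀ hg' h] with α hα h1
  rw [hsum α hα] at h1
  linarith

variable {A : Type*}

lemma collective_mem_omega {w : K → Pair A → ℝ} (hw : ∀ k, w k ∈ Omega A) {α : K → ℝ}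
    (hα : α ∈ Frequencies K) : collective w α ∈ Omega A := by
  have hs := fun p : Pair A => summable_mul_of_mem_frequencies hα fun k => (hw k p).1
  have h0 : ∀ p, 0 ≤ collective w α p := fun p =>
    tsum_nonneg fun k => mul_nonneg (hα.1 k) (hw k p).1.1
  have h1 : ∀ p, collective w α p + collective w α p.rev ≤ 1 := by
    intro p
    unfold collective
    rw [← (hs p).tsum_add (hs p.rev), ← hα.2.tsum_eq]
    refine ((hs p).add (hs p.rev)).tsum_le_tsum (fun k => ?_) hα.2.summable
    rw [← mul_add]
    exact mul_le_of_le_one_right (hα.1 k) (hw k p).2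
  exact fun p => ⟨⟨h0 p, by linarith [h1 p, h0 p.rev]⟩, h1 p⟩

lemma continuousOn_collective {w : K → Pair A → ℝ} (hw : ∀ k, w k ∈ Omega A) :
    ContinuousOn (collective w) (Frequencies K) :=
  continuousOn_pi.2 fun p => continuousOn_tsum_mul fun k => (hw k p).1

end Frequencies

end CLC

theorem mainTheorem4 {A : Type*} [Fintype A] :
    -- the projected scores are well defined
    (∀ v ∈ CLC.Omega A, (∃ ξ : A → A → Prop, CLC.IsAdmissible v ξ) ∧
      ∀ ξ : A → A → Prop, CLC.IsAdmissible v ξ →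
        ∀ s : CLC.Pair A → ℝ, CLC.IsProjection v ξ s ↔ s = CLC.projectedScores v) ∧
    -- the projected scores depend continuously on the Llull matrix
    (∀ p : CLC.Pair A, ContinuousOn (fun v => CLC.projectedScores v p) (CLC.Omega A)) ∧
    -- the rank-like rates depend continuously on the Llull matrix
    (∀ x : A, ContinuousOn (fun v => CLC.rankLikeRate v x) (CLC.Omega A)) ∧
    -- the rank-like rates depend continuously on the relative frequencies of the possible votes
    (∀ (K : Type*) (w : K → CLC.Pair A → ℝ), (∀ k : K, w k ∈ CLC.Omega A) →
      ∀ x : A, ContinuousOn (fun α : K → ℝ => CLC.rankLikeRate (CLC.collective w α) x)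
        (CLC.Frequencies K)) :=
  ⟨fun _ hv => ⟨CLC.exists_isAdmissible hv, fun _ hξ s => CLC.isProjection_iff hv hξ s⟩,
    CLC.continuousOn_projectedScores, CLC.continuousOn_rankLikeRate,
    fun _ _ hw x => (CLC.continuousOn_rankLikeRate x).comp (CLC.continuousOn_collective hw)
      fun _ hα => CLC.collective_mem_omega hw hα⟩
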